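/- Call a continuous function $h:J\to\mathbb{R}$ on an interval $J$ operator convex if $h((1-t)A+tB)\le (1-t)h(A)+th(B)$ for all complex Hilbert spaces $\mathcal{H}$, all bounded self-adjoint operators $A,B$ on $\mathcal{H}$ with spectra in $J$, and all $t\in[0,1]$; it is called operator concave if the reverse inequality always holds. Here $h(A)$ is given by the continuous functional calculus, and $X\le Y$ means that $Y-X$ is a positive operator, i.e. $\langle (Y-X)x,x\rangle\ge 0$ for all $x\in\mathcal{H}$. Let $f:[0,\infty)\to[0,\infty)$ be continuous, and let $g:[0,\infty)\to[0,\infty)$ be strictly increasing and operator convex, such that $g\circ f$ is operator concave. Then $f$ is operator concave. In addition, $g$ maps $[0,\infty)$ bijectively onto $[g(0),\infty)$ with continuous inverse $g^{-1}:[g(0),\infty)\to[0,\infty)$, and for all bounded positive operators $A,B$ on a complex Hilbert space and all $v\in[0,1]$, the operator $(1-v)(g\circ f)(A)+v(g\circ f)(B)$ has spectrum in $[g(0),\infty)$ and $$f\big((1-v)A+vB\big)\;\ge\; g^{-1}\big((1-v)(g\circ f)(A)+v(g\circ f)(B)\big)\;\ge\;(1-v)f(A)+vf(B).$$ -/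

import Mathlib

universe u

/-- A real function `f` on an interval `J` is operator convex if it is continuous on `J` (so that the
continuous functional calculus `f(A) = cfc f A` is defined whenever `A` is self-adjoint with spectrum
in `J`) and `f((1-t)A + tB) ≤ (1-t)f(A) + tf(B)` in the Loewner order for all bounded self-adjoint
operators `A`, `B` with spectra in `J` on any complex Hilbert space and all `t ∈ [0,1]`. -/
def OperatorConvexOn (J : Set ℝ) (f : ℝ → ℝ) : Prop :=
  ContinuousOn f J ∧
    ∀ (H : Type u) [NormedAddCommGroup H] [InnerProductSpace ℂ H] [CompleteSpace H]
      (A B : H →L[ℂ] H), IsSelfAdjoint A → IsSelfAdjoint B →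
      spectrum ℝ A ⊆ J → spectrum ℝ B ⊆ J → ∀ t ∈ Set.Icc (0 : ℝ) 1,
        cfc f ((1 - t) • A + t • B) ≤ (1 - t) • cfc f A + t • cfc f B

/-- Operator concavity: as `OperatorConvexOn`, with the inequality reversed. -/
def OperatorConcaveOn (J : Set ℝ) (f : ℝ → ℝ) : Prop :=
  ContinuousOn f J ∧
    ∀ (H : Type u) [NormedAddCommGroup H] [InnerProductSpace ℂ H] [CompleteSpace H]
      (A B : H →L[ℂ] H), IsSelfAdjoint A → IsSelfAdjoint B →
      spectrum ℝ A ⊆ J → spectrum ℝ B ⊆ J → ∀ t ∈ Set.Icc (0 : ℝ) 1,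
        (1 - t) • cfc f A + t • cfc f B ≤ cfc f ((1 - t) • A + t • B)

/-! The heart is that `g⁻¹` is operator monotone: `g(A) ≤ g(B)` forces `A ≤ B`
(`OperatorConvexOn.le_of_cfc_le_cfc`). Put `X = (1-v)(g∘f)(A) + v(g∘f)(B)`. Concavity of `g∘f` says
`X ≤ g(f((1-v)A+vB))`, convexity of `g` says `g((1-v)f(A)+vf(B)) ≤ X`; cancelling `g` gives both
inequalities, and chaining them gives concavity of `f`.

Cancellation: if `A ≤ B` fails, shift `B` by the least `c > 0` making `E = B + c - A` positive; then
`0` lies in the spectrum of `E`, while `g(B+c) ≥ g(A) + δ` for some `δ > 0`. Since `B + c = (1-1/t)A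
+ (1/t)(A+tE)`, convexity on a unit vector almost killed by `E` gives `δ ≤ R/t` with `R` independent
of `t`, absurd for large `t`. The uniform `R` needs quadratic growth of `g`
(`OperatorConvexOn.le_mul_sq`), obtained by testing convexity on an explicit pair of operators built
from three orthonormal vectors. -/

open ContinuousLinearMap

/-! ### Bounds on quadratic forms of `g(T)` by polynomials in `T` -/

section

variable {H : Type u} [NormedAddCommGroup H] [InnerProductSpace ℂ H]

lemma re_inner_le_of_le {A B : H →L[ℂ] H} (h : A ≤ B) (x : H) :
    (inner ℂ x (A x)).re ≤ (inner ℂ x (B x)).re := by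
  have := (ContinuousLinearMap.le_def A B).1 h |>.re_inner_nonneg_right x
  simpa [inner_sub_right] using this

lemma re_inner_algebraMap (r : ℝ) (x : H) :
    (inner ℂ x (algebraMap ℝ (H →L[ℂ] H) r x)).re = r * ‖x‖ ^ 2 := by
  have : algebraMap ℝ (H →L[ℂ] H) r x = r • x := by
    rw [Algebra.algebraMap_eq_smul_one]; rfl
  rw [this, inner_smul_right_eq_smul, inner_self_eq_norm_sq_to_K]
  norm_cast

variable [CompleteSpace H]

lemma cfc_const_add_mul_sq (T : H →L[ℂ] H) (hT : IsSelfAdjoint T) (a b c : ℝ) :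
    cfc (fun t : ℝ => a + b * t + c * t ^ 2) T = algebraMap ℝ _ a + b • T + c • (T * T) := by
  rw [cfc_add .., cfc_const_add .., cfc_const_mul_id .., cfc_const_mul .., cfc_pow_id .., sq]

lemma cfc_cube_sub_sq (T : H →L[ℂ] H) (hT : IsSelfAdjoint T) (k s : ℝ) :
    cfc (fun t : ℝ => k * (t ^ 3 - s * t ^ 2)) T = k • (T * (T * T) - s • (T * T)) := by
  rw [cfc_const_mul .., cfc_sub .., cfc_const_mul .., cfc_pow_id .., cfc_pow_id .., pow_succ', sq]

/-- The quadratic `g 1 + k' (t² - t)` dominates `g` on `{0, 1, b}` once `k'` is large, and its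
non-constant part vanishes on `x` because `T² x = T x`. Hence the bound does not depend on `g b`. -/
lemma re_inner_cfc_le_of_apply_apply {g : ℝ → ℝ} {b : ℝ} (hb : 1 < b)
    {T : H →L[ℂ] H} (hT : IsSelfAdjoint T) (hspec : spectrum ℝ T ⊆ {0, 1, b})
    (hg1 : g 0 ≤ g 1) {x : H} (hx : T (T x) = T x) :
    (inner ℂ x (cfc g T x)).re ≤ g 1 * ‖x‖ ^ 2 := by
  have hfin : (spectrum ℝ T).Finite := (Set.toFinite _).subset hspec
  set k := |g b| + |g 1|
  set k' := k / (b ^ 2 - b)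
  have hle : cfc g T ≤ cfc (fun t : ℝ => g 1 + (-k') * t + k' * t ^ 2) T := by
    refine cfc_mono (fun t ht => ?_) (hfin.continuousOn _) (hfin.continuousOn _)
    rcases hspec ht with rfl | rfl | rfl
    · simpa using hg1
    · simp
    · have h2 : t ^ 2 - t ≠ 0 := by nlinarith
      have : -k' * t + k' * t ^ 2 = k := by
        have : k' * (t ^ 2 - t) = k := div_mul_cancel₀ _ h2
        linarith
      have h3 := le_abs_self (g t)
      have h4 := neg_abs_le (g 1)
      simp only [k] at this
      linarith
  have := re_inner_le_of_le hle x
  rw [cfc_const_add_mul_sq T hT] at this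
  have hz : (algebraMap ℝ (H →L[ℂ] H) (g 1) + (-k') • T + k' • (T * T)) x =
      algebraMap ℝ (H →L[ℂ] H) (g 1) x := by
    change _ + (-k') • T x + k' • T (T x) = _
    rw [hx, neg_smul, neg_add_cancel_right]
    rfl
  rwa [hz, re_inner_algebraMap] at this

/-- On `[0, b]` the cubic `(g s / b³) t² (t - s)` lies below `g`: it is nonpositive for `t ≤ s`, and
at most `g s ≤ g t` for `t ≥ s`. -/
lemma le_re_inner_cfc_of_moments {g : ℝ → ℝ} (hg_cont : ContinuousOn g (Set.Ici 0))
    (hg_maps : Set.MapsTo g (Set.Ici 0) (Set.Ici 0)) (hg_mono : MonotoneOn g (Set.Ici 0))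
    {s b : ℝ} (hs : 0 ≤ s) (hb : 0 < b) {T : H →L[ℂ] H} (hT : IsSelfAdjoint T)
    (hspec : spectrum ℝ T ⊆ Set.Icc 0 b) (x : H) :
    g s / b ^ 3 * ((inner ℂ (T x) (T (T x))).re - s * ‖T x‖ ^ 2) ≤
      (inner ℂ x (cfc g T x)).re := by
  have hgs : 0 ≤ g s := hg_maps hs
  have hle : cfc (fun t : ℝ => g s / b ^ 3 * (t ^ 3 - s * t ^ 2)) T ≤ cfc g T := by
    refine cfc_mono (fun t ht => ?_) (by fun_prop)
      (hg_cont.mono fun t ht => (hspec ht).1)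
    obtain ⟨h0, h1⟩ := hspec ht
    rcases le_total t s with h | h
    · refine le_trans ?_ (hg_maps h0 : 0 ≤ g t)
      refine mul_nonpos_of_nonneg_of_nonpos (by positivity) ?_
      nlinarith [mul_nonneg (sq_nonneg t) (sub_nonneg.2 h)]
    · refine le_trans ?_ (hg_mono hs h0 h)
      rw [div_mul_eq_mul_div, div_le_iff₀ (by positivity)]
      refine mul_le_mul_of_nonneg_left ?_ hgs
      have : t ^ 3 ≤ b ^ 3 := pow_le_pow_left₀ h0 h1 3
      nlinarith [mul_nonneg hs (sq_nonneg t)]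
  have := re_inner_le_of_le hle x
  rw [cfc_cube_sub_sq T hT] at this
  have hsym : ∀ y z : H, inner ℂ y (T z) = inner ℂ (T y) z := fun y z =>
    (hT.isSymmetric y z).symm
  have h3 : (T * (T * T)) x = T (T (T x)) := rfl
  have h2 : (T * T) x = T (T x) := rfl
  simp only [smul_apply, sub_apply, h3, h2, inner_smul_right_eq_smul, inner_sub_right,
    Complex.smul_re, Complex.sub_re, smul_eq_mul] at this
  rw [hsym x (T x), inner_self_eq_norm_sq_to_K, hsym x (T (T x))] at this
  norm_cast at this

end

/-! ### Quadratic growth of `g` from a three-dimensional test pair -/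

lemma exists_orthonormal_fin_three :
    ∃ (H : Type u) (_ : NormedAddCommGroup H) (_ : InnerProductSpace ℂ H) (_ : CompleteSpace H)
      (e : Fin 3 → H), Orthonormal ℂ e := by
  refine ⟨EuclideanSpace ℂ (ULift.{u} (Fin 3)), inferInstance, inferInstance, inferInstance,
    fun i => EuclideanSpace.basisFun _ ℂ (ULift.up i), ?_⟩
  exact (EuclideanSpace.basisFun (ULift.{u} (Fin 3)) ℂ).orthonormal.comp _ ULift.up_injective

lemma spectrum_subset_of_cubic {A : Type*} [Ring A] [Algebra ℝ A] {T : A} {b : ℝ}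
    (h : T * (T - 1) * (T - algebraMap ℝ A b) = 0) : spectrum ℝ T ⊆ {0, 1, b} := by
  open Polynomial in
  intro t ht
  have h1 := spectrum.subset_polynomial_aeval T (X * (X - 1) * (X - C b)) ⟨t, ht, rfl⟩
  have : Nontrivial A := by
    by_contra hA
    rw [not_nontrivial_iff_subsingleton] at hA
    simp [spectrum.of_subsingleton] at ht
  simp only [map_mul, map_sub, aeval_X, map_one, aeval_C, h, spectrum.zero_eq] at h1
  simp only [eval_mul, eval_sub, eval_X, eval_one, eval_C, Set.mem_singleton_iff,
    mul_eq_zero, sub_eq_zero, or_assoc] at h1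
  simpa using h1

/-- `C` is the mirror image of `B` under a reflection fixing `x`. Neither `B` nor `C` sees its
eigenvalue `b` from `x`, but their midpoint `M` does: `M x` has a component along `e 0`, so the
third moment grows linearly in `b` while the second stays constant. -/
lemma exists_reflected_pair {H : Type u} [NormedAddCommGroup H] [InnerProductSpace ℂ H]
    [CompleteSpace H] {e : Fin 3 → H} (he : Orthonormal ℂ e) (b : ℝ) :
    ∃ (B C M : H →L[ℂ] H) (x : H), IsSelfAdjoint B ∧ IsSelfAdjoint C ∧
      spectrum ℝ B ⊆ {0, 1, b} ∧ spectrum ℝ C ⊆ {0, 1, b} ∧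
      B (B x) = B x ∧ C (C x) = C x ∧ M = (1 - 1 / 2 : ℝ) • B + (1 / 2 : ℝ) • C ∧ ‖x‖ ^ 2 = 2 ∧
      ‖M x‖ ^ 2 = 5 / 6 ∧ (inner ℂ (M x) (M (M x))).re = b / 9 + 25 / 36 := by
  have hee (i j : Fin 3) : inner ℂ (e i) (e j) = if i = j then (1 : ℂ) else 0 :=
    orthonormal_iff_ite.1 he i j
  obtain ⟨n, hn⟩ : ∃ n : H, n = (-2 : ℂ) • e 0 + e 1 - e 2 := ⟨_, rfl⟩
  have hnn : inner ℂ n n = (6 : ℂ) := by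
    simp only [hn, inner_sub_right, inner_add_right, inner_smul_right, inner_sub_left,
      inner_add_left, inner_smul_left, hee]
    norm_num [Fin.ext_iff, map_ofNat]
  have hn0 : inner ℂ n (e 0) = (-2 : ℂ) := by
    simp [hn, inner_smul_left, hee, he.1, map_ofNat]
  have hn1 : inner ℂ n (e 1) = (1 : ℂ) := by
    simp [hn, inner_smul_left, hee, he.1]
  have hn2 : inner ℂ n (e 2) = (-1 : ℂ) := by
    simp [hn, inner_smul_left, hee, he.1]
  obtain ⟨P, hP⟩ : ∃ P : H →L[ℂ] H, P = InnerProductSpace.rankOne ℂ n n := ⟨_, rfl⟩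
  obtain ⟨P₀, hP₀⟩ : ∃ P₀ : H →L[ℂ] H, P₀ = InnerProductSpace.rankOne ℂ (e 0) (e 0) := ⟨_, rfl⟩
  obtain ⟨P₁, hP₁⟩ : ∃ P₁ : H →L[ℂ] H, P₁ = InnerProductSpace.rankOne ℂ (e 1) (e 1) := ⟨_, rfl⟩
  have hPs : IsSelfAdjoint P :=
    hP ▸ (InnerProductSpace.isPositive_rankOne_self n).isSelfAdjoint
  have hP₀s : IsSelfAdjoint P₀ :=
    hP₀ ▸ (InnerProductSpace.isPositive_rankOne_self _).isSelfAdjoint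
  have hP₁s : IsSelfAdjoint P₁ :=
    hP₁ ▸ (InnerProductSpace.isPositive_rankOne_self _).isSelfAdjoint
  have hPP : P * P = (6 : ℝ) • P := by
    ext z
    rw [hP]
    change inner ℂ n (inner ℂ n z • n) • n = (6 : ℝ) • (inner ℂ n z • n)
    rw [inner_smul_right, hnn]
    module
  have h00 : P₀ * P₀ = P₀ :=
    hP₀ ▸ InnerProductSpace.isIdempotentElem_rankOne_self (he.1 0)
  have h11 : P₁ * P₁ = P₁ :=
    hP₁ ▸ InnerProductSpace.isIdempotentElem_rankOne_self (he.1 1)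
  have h01 : P₀ * P₁ = 0 := by
    ext z
    rw [hP₀, hP₁]
    change inner ℂ (e 0) (inner ℂ (e 1) z • e 1) • e 0 = 0
    rw [inner_smul_right, hee]; simp
  have h10 : P₁ * P₀ = 0 := by
    ext z
    rw [hP₀, hP₁]
    change inner ℂ (e 1) (inner ℂ (e 0) z • e 0) • e 1 = 0
    rw [inner_smul_right, hee]; simp
  obtain ⟨B, hB⟩ : ∃ B : H →L[ℂ] H, B = b • P₀ + P₁ := ⟨_, rfl⟩
  -- Reflection in the hyperplane orthogonal to `n`; the factor is `2 / ‖n‖² = 1/3`.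
  obtain ⟨U, hU⟩ : ∃ U : H →L[ℂ] H, U = 1 - (1 / 3 : ℝ) • P := ⟨_, rfl⟩
  have hBs : IsSelfAdjoint B := by
    rw [hB]; exact ((IsSelfAdjoint.all b).smul hP₀s).add hP₁s
  have hUs : IsSelfAdjoint U := by
    rw [hU]; exact (IsSelfAdjoint.one _).sub ((IsSelfAdjoint.all _).smul hPs)
  have hUU : U * U = 1 := by
    simp only [hU, mul_sub, sub_mul, smul_mul_assoc, mul_smul_comm, hPP, one_mul, mul_one]
    module
  have hBc : B * (B - 1) * (B - algebraMap ℝ _ b) = 0 := by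
    simp only [hB, Algebra.algebraMap_eq_smul_one, mul_sub, sub_mul, mul_add, add_mul,
      smul_mul_assoc, mul_smul_comm, h00, h11, h01, h10, mul_one, smul_zero, zero_mul]
    module
  have hCc : (U * B * U) * (U * B * U - 1) * (U * B * U - algebraMap ℝ _ b) = 0 := by
    have e1 : ∀ r : ℝ, U * B * U - algebraMap ℝ _ r = U * (B - algebraMap ℝ _ r) * U := by
      intro r
      calc U * B * U - algebraMap ℝ _ r = U * B * U - algebraMap ℝ _ r * U * U := by
            rw [mul_assoc (algebraMap ℝ _ r), hUU, mul_one]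
        _ = U * (B - algebraMap ℝ _ r) * U := by rw [Algebra.commutes r U]; noncomm_ring
    have e2 := e1 1
    rw [map_one] at e2
    rw [e1, e2]
    calc U * B * U * (U * (B - 1) * U) * (U * (B - algebraMap ℝ _ b) * U)
        = U * B * (U * U) * (B - 1) * (U * U) * (B - algebraMap ℝ _ b) * U := by noncomm_ring
      _ = U * (B * (B - 1) * (B - algebraMap ℝ _ b)) * U := by rw [hUU]; noncomm_ring
      _ = 0 := by rw [hBc]; simp
  obtain ⟨C, hC⟩ : ∃ C : H →L[ℂ] H, C = U * B * U := ⟨_, rfl⟩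
  rw [← hC] at hCc
  have hCs : IsSelfAdjoint C := by
    have := hBs.conjugate U
    rwa [hUs.star_eq, ← hC] at this
  have hBspec := spectrum_subset_of_cubic hBc
  have hCspec := spectrum_subset_of_cubic hCc
  obtain ⟨x, hx⟩ : ∃ x : H, x = e 1 + e 2 := ⟨_, rfl⟩
  have hBv (v : H) : B v = b • (inner ℂ (e 0) v • e 0) + inner ℂ (e 1) v • e 1 := by
    rw [hB, hP₀, hP₁]; rfl
  have hUv (v : H) : U v = v - (1 / 3 : ℝ) • (inner ℂ n v • n) := by
    rw [hU, hP]; rfl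
  have hCv (v : H) : C v = U (B (U v)) := by rw [hC]; rfl
  have hBx : B x = e 1 := by
    rw [hBv]
    simp [hx, hee, he.1]
  have hB0 : B (e 0) = b • e 0 := by
    rw [hBv]
    simp [hee, he.1]
  have hB1 : B (e 1) = e 1 := by
    rw [hBv]
    simp [hee, he.1]
  have hB2 : B (e 2) = 0 := by
    rw [hBv]
    simp [hee]
  have hUx : U x = x := by
    rw [hUv]
    simp [hx, hn1, hn2]
  have hU1 : U (e 1) = (2 / 3 : ℝ) • e 0 + (2 / 3 : ℝ) • e 1 + (1 / 3 : ℝ) • e 2 := by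
    rw [hUv, hn1, hn]
    module
  have hCx : C x = U (e 1) := by
    rw [hCv, hUx, hBx]
  have hUUv (v : H) : U (U v) = v := congrArg (fun T : H →L[ℂ] H => T v) hUU
  have hCCx : C (C x) = C x := by
    rw [hCx, hCv, hUUv, hB1]
  obtain ⟨M, hM⟩ : ∃ M : H →L[ℂ] H, M = (1 - 1 / 2 : ℝ) • B + (1 / 2 : ℝ) • C := ⟨_, rfl⟩
  have hMv (v : H) : M v = (1 - 1 / 2 : ℝ) • B v + (1 / 2 : ℝ) • C v := by rw [hM]; rfl
  have hMx : M x = (1 / 3 : ℝ) • e 0 + (5 / 6 : ℝ) • e 1 + (1 / 6 : ℝ) • e 2 := by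
    rw [hMv, hBx, hCx, hU1]
    module
  -- `M x` is the average of `e 1` and `U (e 1)`, which `U` swaps.
  have hUMx : U (M x) = M x := by
    have hnM : inner ℂ n (M x) = (0 : ℂ) := by
      rw [hMx, inner_add_right, inner_add_right, inner_smul_right_eq_smul,
        inner_smul_right_eq_smul, inner_smul_right_eq_smul, hn0, hn1, hn2]
      norm_num [Complex.ext_iff]
    rw [hUv]
    simp [hnM]
  have hinner (p q r p' q' r' : ℝ) : (inner ℂ (p • e 0 + q • e 1 + r • e 2)
      (p' • e 0 + q' • e 1 + r' • e 2)).re = p * p' + q * q' + r * r' := by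
    simp [inner_add_left, inner_smul_left_eq_smul, inner_smul_right_eq_smul, hee, he.1]
    ring
  have hUsym (y z : H) : inner ℂ y (U z) = inner ℂ (U y) z := (hUs.isSymmetric y z).symm
  have hm3 : (inner ℂ (M x) (M (M x))).re = b / 9 + 25 / 36 := by
    have : inner ℂ (M x) (C (M x)) = inner ℂ (M x) (B (M x)) := by
      rw [hCv, hUsym, hUMx]
    rw [hMv (M x), inner_add_right, inner_smul_right_eq_smul, inner_smul_right_eq_smul, this, ← add_smul]
    have : B (M x) = (b / 3) • e 0 + (5 / 6 : ℝ) • e 1 + (0 : ℝ) • e 2 := by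
      rw [hMx]
      simp only [map_add, map_smul_of_tower, hB0, hB1, hB2]
      module
    rw [this, hMx, Complex.smul_re, hinner, smul_eq_mul]
    ring
  have hsq (v : H) : ‖v‖ ^ 2 = (inner ℂ v v).re := by
    rw [inner_self_eq_norm_sq_to_K]; norm_cast
  have hm2 : ‖M x‖ ^ 2 = 5 / 6 := by
    rw [hsq, hMx, hinner]; norm_num
  have hx2 : ‖x‖ ^ 2 = 2 := by
    have := hinner 0 1 1 0 1 1
    simp only [zero_smul, one_smul, zero_add] at this
    rw [hsq, hx, this]; norm_num
  exact ⟨B, C, M, x, hBs, hCs, hBspec, hCspec, by rw [hBx, hB1], hCCx, hM, hx2,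
    hm2, hm3⟩

lemma OperatorConvexOn.le_mul_sq {g : ℝ → ℝ} (hg_maps : Set.MapsTo g (Set.Ici 0) (Set.Ici 0))
    (hg_mono : MonotoneOn g (Set.Ici 0)) (hg : OperatorConvexOn.{u} (Set.Ici 0) g)
    {s : ℝ} (hs : 1 ≤ s) : g s ≤ 8100 * g 1 * s ^ 2 := by
  -- With `b = 15 s` the moment difference `b/9 + 25/36 - 5s/6` is at least `5s/6`; then `8100 = 2 ·
  -- 15³ · 6/5`.
  obtain ⟨b, hb⟩ : ∃ b : ℝ, b = 15 * s := ⟨_, rfl⟩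
  have hb1 : 1 < b := by linarith
  obtain ⟨H, _, _, _, e, he⟩ := exists_orthonormal_fin_three.{u}
  obtain ⟨B, C, M, x, hBs, hCs, hBspec, hCspec, hBBx, hCCx, hM, hx2, hm2, hm3⟩ :=
    exists_reflected_pair he b
  have hMs : IsSelfAdjoint M :=
    hM ▸ ((IsSelfAdjoint.all _).smul hBs).add ((IsSelfAdjoint.all _).smul hCs)
  have hsub : ({0, 1, b} : Set ℝ) ⊆ Set.Icc 0 b := by
    rintro t (rfl | rfl | rfl) <;> constructor <;> linarith
  have hIci : Set.Icc 0 b ⊆ Set.Ici (0 : ℝ) := fun t ht => ht.1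
  have hMspec : spectrum ℝ M ⊆ Set.Icc 0 b := by
    have h1 : 0 ≤ B := (StarOrderedRing.nonneg_iff_spectrum_nonneg (R := ℝ) B).2
      fun t ht => (hsub (hBspec ht)).1
    have h2 : 0 ≤ C := (StarOrderedRing.nonneg_iff_spectrum_nonneg (R := ℝ) C).2
      fun t ht => (hsub (hCspec ht)).1
    have h3 : B ≤ algebraMap ℝ _ b := le_algebraMap_of_spectrum_le
      fun t ht => (hsub (hBspec ht)).2
    have h4 : C ≤ algebraMap ℝ _ b := le_algebraMap_of_spectrum_le
      fun t ht => (hsub (hCspec ht)).2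
    have h5 : 0 ≤ M := by rw [hM]; norm_num; positivity
    have h6 : M ≤ algebraMap ℝ _ b := by
      calc M ≤ (1 - 1 / 2 : ℝ) • algebraMap ℝ _ b + (1 / 2 : ℝ) • algebraMap ℝ _ b := by
            rw [hM]; norm_num; gcongr
        _ = _ := by module
    exact fun t ht => ⟨spectrum_nonneg_of_nonneg h5 ht,
      (le_algebraMap_iff_spectrum_le (a := M)).1 h6 t ht⟩
  have hcv := re_inner_le_of_le (hg.2 H B C hBs hCs (hBspec.trans (hsub.trans hIci))
    (hCspec.trans (hsub.trans hIci)) (1 / 2) ⟨by norm_num, by norm_num⟩) x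
  have hg01 : g 0 ≤ g 1 := hg_mono (by simp) (by simp) zero_le_one
  have hBle := re_inner_cfc_le_of_apply_apply hb1 hBs hBspec hg01 hBBx
  have hCle := re_inner_cfc_le_of_apply_apply hb1 hCs hCspec hg01 hCCx
  have hlow := le_re_inner_cfc_of_moments hg.1 hg_maps hg_mono (s := s) (by linarith)
    (by linarith) hMs hMspec x
  have hsplit : (inner ℂ x (((1 - 1 / 2 : ℝ) • cfc g B + (1 / 2 : ℝ) • cfc g C) x)).re =
      (1 / 2) * (inner ℂ x (cfc g B x)).re + (1 / 2) * (inner ℂ x (cfc g C x)).re := by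
    change (inner ℂ x ((1 - 1 / 2 : ℝ) • cfc g B x + (1 / 2 : ℝ) • cfc g C x)).re = _
    rw [inner_add_right, inner_smul_right_eq_smul, inner_smul_right_eq_smul, Complex.add_re,
      Complex.smul_re, Complex.smul_re, smul_eq_mul, smul_eq_mul]
    norm_num
  rw [hsplit, ← hM] at hcv
  rw [hm3, hm2] at hlow
  rw [hx2] at hBle hCle
  have hfin : g s / b ^ 3 * (5 / 6 * s) ≤ g 1 * 2 := by
    refine le_trans ?_ (hlow.trans (hcv.trans (by linarith)))
    have : 0 ≤ g s := hg_maps (by simp; linarith)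
    refine mul_le_mul_of_nonneg_left ?_ (by positivity)
    rw [hb]; linarith
  have hs0 : 0 < s := by linarith
  rw [hb, div_mul_eq_mul_div, div_le_iff₀ (by positivity)] at hfin
  have : s * (5 / 6 * g s) ≤ s * (g 1 * 2 * (3375 * s ^ 2)) := by linarith
  have := le_of_mul_le_mul_left this hs0
  linarith

/-! ### Operator monotonicity of the inverse of `g` -/

section

variable {H : Type u} [NormedAddCommGroup H] [InnerProductSpace ℂ H] [CompleteSpace H]

lemma spectrum_subset_Ici_of_nonneg {A : H →L[ℂ] H} (h : 0 ≤ A) :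
    spectrum ℝ A ⊆ Set.Ici 0 := fun _ ht => spectrum_nonneg_of_nonneg h ht

lemma nonneg_of_spectrum_subset_Ici {A : H →L[ℂ] H} (hA : IsSelfAdjoint A)
    (h : spectrum ℝ A ⊆ Set.Ici 0) : 0 ≤ A :=
  (StarOrderedRing.nonneg_iff_spectrum_nonneg (R := ℝ) A).2 fun _ ht => h ht

/-- Otherwise `E` is bounded below, so `E²` is coercive, hence invertible, and so is `E`. -/
lemma exists_norm_apply_lt_of_zero_mem_spectrum {E : H →L[ℂ] H} (hE : IsSelfAdjoint E)
    (h0 : (0 : ℝ) ∈ spectrum ℝ E) {ε : ℝ} (hε : 0 < ε) : ∃ x : H, ‖E x‖ < ε * ‖x‖ := by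
  by_contra! hcon
  refine spectrum.zero_notMem ℝ ?_ h0
  have hsq : IsUnit (E * E) := by
    refine isUnit_of_forall_le_norm_inner_map (E * E) (c := (ε ^ 2).toNNReal) (by positivity)
      fun x => ?_
    have h1 : inner ℂ ((E * E) x) x = ((‖E x‖ ^ 2 : ℝ) : ℂ) := by
      change inner ℂ (E (E x)) x = _
      rw [show inner ℂ (E (E x)) x = inner ℂ (E x) (E x) from hE.isSymmetric _ _,
        inner_self_eq_norm_sq_to_K]
      norm_cast
    rw [h1, Complex.norm_real, Real.norm_of_nonneg (by positivity), Real.coe_toNNReal _ (by positivity)]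
    have := pow_le_pow_left₀ (by positivity) (hcon x) 2
    linarith [mul_pow ε ‖x‖ 2]
  exact (isUnit_pow_iff two_ne_zero).1 (by rwa [sq])

/-- Here `c` is the maximum of the spectrum of `A - B`. -/
lemma exists_zero_mem_spectrum_of_not_le {A B : H →L[ℂ] H} (hA : IsSelfAdjoint A)
    (hB : IsSelfAdjoint B) (h : ¬ A ≤ B) :
    ∃ c : ℝ, 0 < c ∧ 0 ≤ B + algebraMap ℝ _ c - A ∧
      (0 : ℝ) ∈ spectrum ℝ (B + algebraMap ℝ _ c - A) := by
  have hD : IsSelfAdjoint (A - B) := hA.sub hB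
  have hex : ∃ t ∈ spectrum ℝ (A - B), 0 < t := by
    by_contra! hcon
    have := le_algebraMap_of_spectrum_le (r := 0) (a := A - B) hcon
    rw [map_zero, sub_nonpos] at this
    exact h this
  obtain ⟨t, ht, ht0⟩ := hex
  obtain ⟨c, hc, hmax⟩ := (spectrum.isCompact (𝕜 := ℝ) (A - B)).exists_isMaxOn ⟨t, ht⟩ continuousOn_id
  have heq : B + algebraMap ℝ _ c - A = algebraMap ℝ _ c - (A - B) := by abel
  refine ⟨c, ht0.trans_le (hmax ht), ?_, ?_⟩
  · rw [heq, sub_nonneg]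
    exact le_algebraMap_of_spectrum_le fun s hs => hmax hs
  · rw [heq, ← spectrum.singleton_sub_eq]
    exact ⟨c, rfl, c, hc, sub_self c⟩

/-- `δ` is the minimum of `g (t + c) - g t` over a compact interval containing the spectrum of `B`;
strict monotonicity makes it positive. -/
lemma cfc_add_algebraMap_le {g : ℝ → ℝ} (hg_cont : ContinuousOn g (Set.Ici 0))
    (hg_incr : StrictMonoOn g (Set.Ici 0)) {B : H →L[ℂ] H} (hB : 0 ≤ B) {c : ℝ} (hc : 0 < c) :
    ∃ δ > 0, cfc g B + algebraMap ℝ _ δ ≤ cfc g (B + algebraMap ℝ _ c) := by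
  have hBs : IsSelfAdjoint B := .of_nonneg hB
  have hmaps : Set.MapsTo (fun t : ℝ => t + c) (Set.Ici 0) (Set.Ici 0) :=
    fun t ht => by have : (0 : ℝ) ≤ t := ht; simp; linarith
  have hcont : ContinuousOn (fun t => g (t + c)) (Set.Ici 0) :=
    hg_cont.comp (by fun_prop) hmaps
  have hspec := spectrum_subset_Ici_of_nonneg hB
  obtain ⟨m, hm, hmin⟩ := (isCompact_Icc (a := (0 : ℝ)) (b := ‖B‖ * ‖(1 : H →L[ℂ] H)‖)).exists_isMinOn
    ⟨0, le_rfl, by positivity⟩ ((hcont.sub hg_cont).mono Set.Icc_subset_Ici_self)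
  refine ⟨g (m + c) - g m, sub_pos.2 (hg_incr hm.1 (hmaps hm.1) (by linarith)), ?_⟩
  have h1 : cfc g (B + algebraMap ℝ _ c) = cfc (fun t => g (t + c)) B := by
    have h2 : B + algebraMap ℝ _ c = cfc (fun t : ℝ => t + c) B := by
      rw [cfc_add_const .., cfc_id' ..]
    rw [h2, ← cfc_comp' g (fun t => t + c) B
      (hg_cont.mono (Set.image_subset_iff.2 fun t ht => hmaps (hspec ht)))]
  rw [h1, ← cfc_add_const _ _ _ (hg_cont.mono hspec)]
  refine cfc_mono (fun t ht => ?_) ((hg_cont.mono hspec).add continuousOn_const)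
    (hcont.mono hspec)
  have htB := (le_abs_self t).trans (spectrum.norm_le_norm_mul_of_mem ht)
  have : g (m + c) - g m ≤ g (t + c) - g t := hmin ⟨hspec ht, htB⟩
  linarith

lemma re_inner_cfc_le_of_quadratic {g : ℝ → ℝ} (hg_cont : ContinuousOn g (Set.Ici 0)) {a b : ℝ}
    (hg : ∀ t, 0 ≤ t → g t ≤ a + b * t ^ 2) {T : H →L[ℂ] H} (hT : 0 ≤ T) (x : H) :
    (inner ℂ x (cfc g T x)).re ≤ a * ‖x‖ ^ 2 + b * ‖T x‖ ^ 2 := by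
  have hTs : IsSelfAdjoint T := .of_nonneg hT
  have hspec := spectrum_subset_Ici_of_nonneg hT
  have hle : cfc g T ≤ cfc (fun t => a + b * t ^ 2) T :=
    cfc_mono (fun t ht => hg t (hspec ht)) (hg_cont.mono hspec) (by fun_prop)
  rw [cfc_const_add .., cfc_const_mul .., cfc_pow_id ..] at hle
  have := re_inner_le_of_le hle x
  have hz : (algebraMap ℝ (H →L[ℂ] H) a + b • T ^ 2) x =
      algebraMap ℝ (H →L[ℂ] H) a x + b • T (T x) := by rw [sq]; rfl
  rw [hz, inner_add_right, Complex.add_re, re_inner_algebraMap, inner_smul_right_eq_smul,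
    Complex.smul_re, show inner ℂ x (T (T x)) = inner ℂ (T x) (T x) from
      (hTs.isSymmetric _ _).symm, inner_self_eq_norm_sq_to_K] at this
  norm_cast at this

/-- The inverse of a strictly increasing operator convex function is operator monotone. -/
theorem OperatorConvexOn.le_of_cfc_le_cfc {g : ℝ → ℝ}
    (hg_maps : Set.MapsTo g (Set.Ici 0) (Set.Ici 0)) (hg_incr : StrictMonoOn g (Set.Ici 0))
    (hg : OperatorConvexOn.{u} (Set.Ici 0) g) {A B : H →L[ℂ] H} (hA : 0 ≤ A) (hB : 0 ≤ B)
    (hAB : cfc g A ≤ cfc g B) : A ≤ B := by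
  by_contra hcon
  have hAs : IsSelfAdjoint A := .of_nonneg hA
  obtain ⟨c, hc, hE, h0⟩ := exists_zero_mem_spectrum_of_not_le hAs (.of_nonneg hB) hcon
  obtain ⟨δ, hδ, hδle⟩ := cfc_add_algebraMap_le hg.1 hg_incr hB hc
  set C := B + algebraMap ℝ _ c with hC
  set E := C - A with hEdef
  have hEs : IsSelfAdjoint E := .of_nonneg hE
  have hg1 : 0 ≤ g 1 := hg_maps (Set.mem_Ici.2 zero_le_one)
  set K := 8100 * g 1
  have hK : 0 ≤ K := by positivity
  have hquad : ∀ t, 0 ≤ t → g t ≤ g 1 + K * t ^ 2 := by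
    intro t ht
    rcases le_total t 1 with h | h
    · have := hg_incr.monotoneOn ht (zero_le_one : (0 : ℝ) ≤ 1) h
      nlinarith [mul_nonneg hK (sq_nonneg t)]
    · have := hg.le_mul_sq hg_maps hg_incr.monotoneOn h
      linarith
  -- `R ‖x‖²` will bound the form of `g (A + tE)` at `x`, because `‖E x‖ < ‖x‖ / t` gives `‖(A + tE)
  -- x‖ ≤ (‖A‖ + 1) ‖x‖`. Taking `t = R/δ + 1` makes `t δ = R + δ` exceed `R`.
  set R := g 1 + K * (‖A‖ + 1) ^ 2
  have hR : 0 ≤ R := by positivity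
  set t := R / δ + 1
  have ht1 : 1 ≤ t := by simp only [t]; linarith [div_nonneg hR hδ.le]
  have ht0 : 0 < t := by linarith
  obtain ⟨x, hx⟩ := exists_norm_apply_lt_of_zero_mem_spectrum hEs h0 (inv_pos.2 ht0)
  have hx0 : 0 < ‖x‖ := by
    by_contra! h
    have : ‖x‖ = 0 := le_antisymm h (norm_nonneg x)
    rw [this, mul_zero] at hx
    exact absurd hx (norm_nonneg _).not_gt
  have hT : 0 ≤ A + t • E := by positivity
  have hconv := hg.2 H A (A + t • E) hAs (.of_nonneg hT) (spectrum_subset_Ici_of_nonneg hA)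
    (spectrum_subset_Ici_of_nonneg hT) t⁻¹ ⟨by positivity, inv_le_one_of_one_le₀ ht1⟩
  have hcomb : (1 - t⁻¹) • A + t⁻¹ • (A + t • E) = C := by
    rw [smul_add, smul_smul, inv_mul_cancel₀ ht0.ne', hEdef]
    module
  rw [hcomb] at hconv
  have h1 := re_inner_le_of_le (((add_le_add_left hAB _).trans hδle).trans hconv) x
  have h2 := re_inner_cfc_le_of_quadratic hg.1 hquad hT x
  have h3 : 0 ≤ (inner ℂ x (cfc g A x)).re := by
    have : 0 ≤ cfc g A :=
      cfc_nonneg fun s hs => hg_maps (spectrum_subset_Ici_of_nonneg hA hs)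
    simpa using re_inner_le_of_le this x
  have hTx : ‖(A + t • E) x‖ ≤ (‖A‖ + 1) * ‖x‖ := by
    calc ‖A x + t • E x‖ ≤ ‖A x‖ + ‖t • E x‖ := norm_add_le _ _
      _ ≤ ‖A‖ * ‖x‖ + t * (t⁻¹ * ‖x‖) := by
        rw [norm_smul, Real.norm_of_nonneg ht0.le]
        gcongr
        exact A.le_opNorm x
      _ = _ := by field_simp
  have h4 : (inner ℂ x (cfc g (A + t • E) x)).re ≤ R * ‖x‖ ^ 2 := by
    have := pow_le_pow_left₀ (norm_nonneg _) hTx 2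
    calc _ ≤ _ := h2
      _ ≤ g 1 * ‖x‖ ^ 2 + K * ((‖A‖ + 1) * ‖x‖) ^ 2 := by gcongr
      _ = _ := by ring
  have h5 : (inner ℂ x ((cfc g A + algebraMap ℝ (H →L[ℂ] H) δ) x)).re =
      (inner ℂ x (cfc g A x)).re + δ * ‖x‖ ^ 2 := by
    rw [_root_.add_apply, inner_add_right, Complex.add_re, re_inner_algebraMap]
  have h6 : (inner ℂ x (((1 - t⁻¹) • cfc g A + t⁻¹ • cfc g (A + t • E)) x)).re =
      (1 - t⁻¹) * (inner ℂ x (cfc g A x)).re +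
        t⁻¹ * (inner ℂ x (cfc g (A + t • E) x)).re := by
    change (inner ℂ x ((1 - t⁻¹) • cfc g A x + t⁻¹ • cfc g (A + t • E) x)).re = _
    rw [inner_add_right, inner_smul_right_eq_smul, inner_smul_right_eq_smul, Complex.add_re,
      Complex.smul_re, Complex.smul_re, smul_eq_mul, smul_eq_mul]
  rw [h5, h6] at h1
  have hti : 0 < t⁻¹ := inv_pos.2 ht0
  have h7 : δ * ‖x‖ ^ 2 ≤ t⁻¹ * (R * ‖x‖ ^ 2) := by
    nlinarith [mul_nonneg hti.le h3, mul_le_mul_of_nonneg_left h4 hti.le]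
  have hx2 : 0 < ‖x‖ ^ 2 := by positivity
  have h8 : t * δ ≤ R := by
    rw [inv_mul_eq_div, le_div_iff₀ ht0] at h7
    refine le_of_mul_le_mul_right ?_ hx2
    linarith
  have h9 : t * δ = R + δ := by simp only [t]; field_simp
  linarith

end

/-! ### Scalar convexity and the continuous inverse of `g` -/

/-- Apply operator convexity to scalar operators on a nonzero space. -/
lemma OperatorConvexOn.convexOn {J : Set ℝ} (hJ : Convex ℝ J) {g : ℝ → ℝ}
    (hg : OperatorConvexOn.{u} J g) : ConvexOn ℝ J g := by
  obtain ⟨H, _, _, _, e, he⟩ := exists_orthonormal_fin_three.{u}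
  have hne : Nontrivial H := ⟨e 0, 0, fun h => by simpa [h] using he.1 0⟩
  refine ⟨hJ, fun x hx y hy a b ha hb hab => ?_⟩
  obtain rfl : a = 1 - b := by linarith
  have hspec (r : ℝ) (hr : r ∈ J) : spectrum ℝ (algebraMap ℝ (H →L[ℂ] H) r) ⊆ J := by
    rw [spectrum.scalar_eq]; simpa using hr
  have h := hg.2 H (algebraMap ℝ _ x) (algebraMap ℝ _ y) (cfc_predicate_algebraMap x)
    (cfc_predicate_algebraMap y) (hspec x hx) (hspec y hy) b ⟨hb, by linarith⟩
  simp only [cfc_algebraMap, ← map_add, Algebra.smul_def, ← map_mul] at h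
  have := re_inner_le_of_le h (e 0)
  rw [re_inner_algebraMap, re_inner_algebraMap, he.1 0] at this
  simpa using this

lemma bijOn_Ici_of_convexOn {g : ℝ → ℝ} (hg_cont : ContinuousOn g (Set.Ici 0))
    (hg_incr : StrictMonoOn g (Set.Ici 0)) (hg : ConvexOn ℝ (Set.Ici 0) g) :
    Set.BijOn g (Set.Ici 0) (Set.Ici (g 0)) := by
  have h0 : (0 : ℝ) ∈ Set.Ici (0 : ℝ) := Set.mem_Ici.2 le_rfl
  refine ⟨fun x hx => hg_incr.monotoneOn h0 hx hx, hg_incr.injOn, fun y hy => ?_⟩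
  set d := g 1 - g 0
  have hd : 0 < d := sub_pos.2 (hg_incr h0 (zero_le_one : (0 : ℝ) ≤ 1) zero_lt_one)
  -- At this `s` the line through `(0, g 0)` and `(1, g 1)` has height `y + d`; by convexity `g s`
  -- is at least that, so the intermediate value theorem reaches `y`.
  set s := 1 + (y - g 0) / d
  have hy' : 0 ≤ y - g 0 := sub_nonneg.2 hy
  have hs : 1 ≤ s := by simp only [s]; linarith [div_nonneg hy' hd.le]
  have hs0 : 0 < s := by linarith
  have h1 := hg.2 h0 (Set.mem_Ici.2 hs0.le) (sub_nonneg.2 (inv_le_one_of_one_le₀ hs))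
    (inv_nonneg.2 hs0.le) (sub_add_cancel 1 s⁻¹)
  simp only [smul_eq_mul, mul_zero, zero_add, inv_mul_cancel₀ hs0.ne'] at h1
  have h2 : s * g 1 ≤ (s - 1) * g 0 + g s := by
    calc s * g 1 ≤ s * ((1 - s⁻¹) * g 0 + s⁻¹ * g s) := by gcongr
      _ = _ := by field_simp
  have h3 : s * d = d + (y - g 0) := by simp only [s]; field_simp
  have h4 : y ≤ g s := by simp only [d] at h3 hd; nlinarith
  obtain ⟨x, hx, rfl⟩ := intermediate_value_Icc hs0.le (hg_cont.mono Set.Icc_subset_Ici_self)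
    (⟨hy, h4⟩ : y ∈ Set.Icc (g 0) (g s))
  exact ⟨x, hx.1, rfl⟩

/-- A strictly increasing bijection between these rays is an order isomorphism, so its inverse is
continuous for the order topologies. -/
lemma continuousOn_invFunOn_Ici {g : ℝ → ℝ} (hg_incr : StrictMonoOn g (Set.Ici 0))
    (hbij : Set.BijOn g (Set.Ici 0) (Set.Ici (g 0))) :
    ContinuousOn (Function.invFunOn g (Set.Ici 0)) (Set.Ici (g 0)) := by
  have hinv := hbij.invOn_invFunOn
  let φ : Set.Ici (0 : ℝ) ≃ Set.Ici (g 0) := hbij.equiv g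
  let ψ : Set.Ici (0 : ℝ) ≃o Set.Ici (g 0) :=
    { φ with map_rel_iff' := fun {a b} => hg_incr.le_iff_le a.2 b.2 }
  rw [continuousOn_iff_continuous_domRestrict]
  have : (Set.Ici (g 0)).domRestrict (Function.invFunOn g (Set.Ici 0)) = fun y => (ψ.symm y : ℝ) := by
    funext y
    obtain ⟨x, rfl⟩ := ψ.surjective y
    rw [OrderIso.symm_apply_apply]
    exact hinv.1 x.2
  rw [this]
  exact continuous_subtype_val.comp ψ.symm.continuous

/-! ### The sandwich inequality and concavity of `f` -/

theorem mainTheorem10 (f g : ℝ → ℝ)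
    (hf_maps : Set.MapsTo f (Set.Ici 0) (Set.Ici 0))
    (hf_cont : ContinuousOn f (Set.Ici 0))
    (hg_maps : Set.MapsTo g (Set.Ici 0) (Set.Ici 0))
    (hg_incr : StrictMonoOn g (Set.Ici 0))
    (hg_conv : OperatorConvexOn.{u} (Set.Ici 0) g)
    (hgf_conc : OperatorConcaveOn.{u} (Set.Ici 0) (g ∘ f)) :
    OperatorConcaveOn.{u} (Set.Ici 0) f ∧
    -- the inverse of `g` is a continuous function from `[g(0), ∞)` onto `[0, ∞)`
    Set.BijOn g (Set.Ici 0) (Set.Ici (g 0)) ∧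
    ContinuousOn (Function.invFunOn g (Set.Ici 0)) (Set.Ici (g 0)) ∧
    ∀ (H : Type u) [NormedAddCommGroup H] [InnerProductSpace ℂ H] [CompleteSpace H]
      (A B : H →L[ℂ] H), A.IsPositive → B.IsPositive → ∀ v ∈ Set.Icc (0 : ℝ) 1,
      spectrum ℝ ((1 - v) • cfc (g ∘ f) A + v • cfc (g ∘ f) B) ⊆ Set.Ici (g 0) ∧
      cfc (Function.invFunOn g (Set.Ici 0)) ((1 - v) • cfc (g ∘ f) A + v • cfc (g ∘ f) B)
        ≤ cfc f ((1 - v) • A + v • B) ∧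
      (1 - v) • cfc f A + v • cfc f B
        ≤ cfc (Function.invFunOn g (Set.Ici 0)) ((1 - v) • cfc (g ∘ f) A + v • cfc (g ∘ f) B) := by
  have hbij := bijOn_Ici_of_convexOn hg_conv.1 hg_incr (hg_conv.convexOn (convex_Ici 0))
  have hinv := continuousOn_invFunOn_Ici hg_incr hbij
  have key : ∀ (H : Type u) [NormedAddCommGroup H] [InnerProductSpace ℂ H] [CompleteSpace H]
      (A B : H →L[ℂ] H), A.IsPositive → B.IsPositive → ∀ v ∈ Set.Icc (0 : ℝ) 1,
      spectrum ℝ ((1 - v) • cfc (g ∘ f) A + v • cfc (g ∘ f) B) ⊆ Set.Ici (g 0) ∧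
      cfc (Function.invFunOn g (Set.Ici 0)) ((1 - v) • cfc (g ∘ f) A + v • cfc (g ∘ f) B)
        ≤ cfc f ((1 - v) • A + v • B) ∧
      (1 - v) • cfc f A + v • cfc f B
        ≤ cfc (Function.invFunOn g (Set.Ici 0))
          ((1 - v) • cfc (g ∘ f) A + v • cfc (g ∘ f) B) := by
    intro H _ _ _ A B hA hB v hv
    have hv0 : 0 ≤ v := hv.1
    have hv1 : 0 ≤ 1 - v := sub_nonneg.2 hv.2
    have hA0 : 0 ≤ A := (nonneg_iff_isPositive A).2 hA
    have hB0 : 0 ≤ B := (nonneg_iff_isPositive B).2 hB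
    have hM0 : 0 ≤ (1 - v) • A + v • B := by positivity
    have hcf {T : H →L[ℂ] H} (hT : 0 ≤ T) : 0 ≤ cfc f T :=
      cfc_nonneg fun t ht => hf_maps (spectrum_subset_Ici_of_nonneg hT ht)
    have hcomp {T : H →L[ℂ] H} (hT : 0 ≤ T) : cfc (g ∘ f) T = cfc g (cfc f T) := by
      have hs := spectrum_subset_Ici_of_nonneg hT
      exact cfc_comp g f T (.of_nonneg hT)
        (hg_conv.1.mono (Set.image_subset_iff.2 fun t ht => hf_maps (hs ht))) (hf_cont.mono hs)
    have hge {T : H →L[ℂ] H} (hT : 0 ≤ T) : algebraMap ℝ _ (g 0) ≤ cfc (g ∘ f) T := by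
      have hs := spectrum_subset_Ici_of_nonneg hT
      exact algebraMap_le_cfc _ _ _ (fun t ht => hbij.1 (hf_maps (hs ht)))
        (hgf_conc.1.mono hs) (.of_nonneg hT)
    set X := (1 - v) • cfc (g ∘ f) A + v • cfc (g ∘ f) B with hX
    have hXs : IsSelfAdjoint X := ((IsSelfAdjoint.all _).smul (cfc_predicate _ _)).add
      ((IsSelfAdjoint.all _).smul (cfc_predicate _ _))
    have hXge : algebraMap ℝ _ (g 0) ≤ X := by
      calc algebraMap ℝ (H →L[ℂ] H) (g 0)
          = (1 - v) • algebraMap ℝ _ (g 0) + v • algebraMap ℝ _ (g 0) := by module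
        _ ≤ X := add_le_add (smul_le_smul_of_nonneg_left (hge hA0) hv1)
          (smul_le_smul_of_nonneg_left (hge hB0) hv0)
    have hXspec : spectrum ℝ X ⊆ Set.Ici (g 0) :=
      fun t ht => (algebraMap_le_iff_le_spectrum (a := X)).1 hXge t ht
    have hmaps := hbij.surjOn.mapsTo_invFunOn
    set k := Function.invFunOn g (Set.Ici 0)
    have hY0 : 0 ≤ cfc k X := cfc_nonneg fun t ht => hmaps (hXspec ht)
    have hgY : cfc g (cfc k X) = X := by
      rw [← cfc_comp' g k X (hg_conv.1.mono (Set.image_subset_iff.2 fun t ht => hmaps (hXspec ht)))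
        (hinv.mono hXspec)]
      conv_rhs => rw [← cfc_id' ℝ X]
      exact cfc_congr fun t ht => hbij.invOn_invFunOn.2 (hXspec ht)
    refine ⟨hXspec, ?_, ?_⟩
    -- After cancelling `g`, this is operator concavity of `g ∘ f`.
    · refine hg_conv.le_of_cfc_le_cfc hg_maps hg_incr hY0 (hcf hM0) ?_
      rw [hgY, ← hcomp hM0]
      exact hgf_conc.2 H A B (.of_nonneg hA0) (.of_nonneg hB0) (spectrum_subset_Ici_of_nonneg hA0)
        (spectrum_subset_Ici_of_nonneg hB0) v hv
    · have hS : 0 ≤ (1 - v) • cfc f A + v • cfc f B :=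
        add_nonneg (smul_nonneg hv1 (hcf hA0)) (smul_nonneg hv0 (hcf hB0))
      -- After cancelling `g`, this is operator convexity of `g` at `f(A)` and `f(B)`.
      refine hg_conv.le_of_cfc_le_cfc hg_maps hg_incr hS hY0 ?_
      rw [hgY, hX, hcomp hA0, hcomp hB0]
      exact hg_conv.2 H _ _ (cfc_predicate _ _) (cfc_predicate _ _)
        (spectrum_subset_Ici_of_nonneg (hcf hA0)) (spectrum_subset_Ici_of_nonneg (hcf hB0)) v hv
  refine ⟨⟨hf_cont, ?_⟩, hbij, hinv, key⟩
  intro H _ _ _ A B hA hB hAs hBs v hv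
  obtain ⟨-, h1, h2⟩ := key H A B
    ((nonneg_iff_isPositive A).1 (nonneg_of_spectrum_subset_Ici hA hAs))
    ((nonneg_iff_isPositive B).1 (nonneg_of_spectrum_subset_Ici hB hBs)) v hv
  exact h2.trans h1
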